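/- Let $K$ be a field of characteristic $0$ and let $A_1$ be the first Weyl algebra over $K$, i.e. the associative unital $K$-algebra generated by $p,q$ subject to $[p,q]=pq-qp=1$. For $t\in\mathbb{Z}$ let $D_t=\operatorname{Span}_K\{p^iq^s \mid i,s\in\mathbb{Z}_{\ge 0},\ s-i=t\}$, so that $A_1=\bigoplus_{t\in\mathbb{Z}}D_t$, and let $D_{\le 0}=\bigoplus_{t\le 0}D_t$. Let $\operatorname{Aut}(A_1)$ be the group of $K$-algebra automorphisms of $A_1$. Say that the Dixmier conjecture holds for $A_1$ if any $z,w\in A_1$ with $[z,w]=zw-wz=1$ generate $A_1$ as a $K$-algebra (equivalently, if every $K$-algebra endomorphism of $A_1$ is an automorphism). Then the Dixmier conjecture holds for $A_1$ if and only if for any $z,w\in A_1$ with $[z,w]=1$ there exists some $\psi\in\operatorname{Aut}(A_1)$ such that $\psi(z)\in D_{\le 0}$. -/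

import Mathlib

universe u

namespace FirstWeyl

/-- The defining relation `pq - qp = 1` on the free `K`-algebra on two generators
(generator `0` is `p`, generator `1` is `q`). -/
inductive Rel (K : Type u) [Field K] :
    FreeAlgebra K (Fin 2) → FreeAlgebra K (Fin 2) → Prop
  | comm : Rel K
      (FreeAlgebra.ι K 0 * FreeAlgebra.ι K 1 - FreeAlgebra.ι K 1 * FreeAlgebra.ι K 0) 1

/-- The first Weyl algebra `A₁` over `K`: the associative unital `K`-algebra generated by
`p, q` subject to `pq - qp = 1`. -/
def A₁ (K : Type u) [Field K] : Type u := RingQuot (Rel K)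

instance (K : Type u) [Field K] : Ring (A₁ K) :=
  inferInstanceAs (Ring (RingQuot (Rel K)))

instance (K : Type u) [Field K] : Algebra K (A₁ K) :=
  inferInstanceAs (Algebra K (RingQuot (Rel K)))

/-- The generator `p` of `A₁`. -/
def p (K : Type u) [Field K] : A₁ K := RingQuot.mkAlgHom K (Rel K) (FreeAlgebra.ι K 0)

/-- The generator `q` of `A₁`. -/
def q (K : Type u) [Field K] : A₁ K := RingQuot.mkAlgHom K (Rel K) (FreeAlgebra.ι K 1)

/-- The homogeneous component `D_t = Span {p^i q^s | s - i = t}` of `A₁`, for `t ∈ ℤ`. -/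
def D (K : Type u) [Field K] (t : ℤ) : Submodule K (A₁ K) :=
  Submodule.span K {x | ∃ i s : ℕ, (s : ℤ) - (i : ℤ) = t ∧ x = p K ^ i * q K ^ s}

/-- `D_{≤ i}`, the sum of all the components `D_t` with `t ≤ i`. -/
def DLe (K : Type u) [Field K] (i : ℤ) : Submodule K (A₁ K) :=
  ⨆ t : ℤ, ⨆ _ : t ≤ i, D K t

/-- The Dixmier conjecture for the first Weyl algebra over `K`: any two elements
`z, w` of `A₁` with `[z, w] = 1` generate `A₁` as a `K`-algebra. -/
def DixmierConjecture (K : Type u) [Field K] : Prop :=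
  ∀ z w : A₁ K, z * w - w * z = 1 → Algebra.adjoin K {z, w} = ⊤

end FirstWeyl

open Polynomial

namespace FirstWeyl

/-! ### Normal ordering for a pair with commutator 1 -/

section Commutators

variable {K : Type u} [Field K] {R : Type*} [Ring R] [Algebra K R] {P Q : R}

/-! If `z, w` generate, the endomorphism `p ↦ z`, `q ↦ w` is onto; it is injective in characteristic
0 (`algHom_injective`), and its inverse sends `z` to `p`, which lies in `D K (-1)`.

Conversely, generation is invariant under automorphisms, so one may take `z ∈ DLe K 0`. The core is
`eq_affine_of_mem_DLe`: such a `z` is `c + a p` with `a ≠ 0`. Then `a w - q` centralizes `p`, hence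
lies in `K[p]`, and `p, q` are recovered from `z, w`.

For the core, embed `A₁` in the skew Laurent ring by `p ↦ T`, `q ↦ X T⁻¹`, so that `z` has only
nonnegative powers of `T`. Comparison with the lowest term of `w` makes the `T⁰` coefficient of `z`
a constant, which is subtracted. The lowest terms are then `a T` and a linear polynomial times `T⁻¹`
(`initial_terms_of_commutator`). A Newton polygon argument (`cf_eq_zero_of_commutator`) excludes
further terms of `z`: they would give the commutator a nonzero term in positive `T`-degree. -/

lemma mul_pow_sub_pow_mul (h : P * Q - Q * P = 1) (n : ℕ) :
    P * Q ^ n - Q ^ n * P = n * Q ^ (n - 1) := by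
  induction n with
  | zero => simp
  | succ n ih =>
    have e : P * Q ^ (n + 1) - Q ^ (n + 1) * P
        = (P * Q ^ n - Q ^ n * P) * Q + Q ^ n * (P * Q - Q * P) := by
      rw [pow_succ]; noncomm_ring
    rw [e, ih, h]
    rcases n with _ | n
    · simp
    · simp only [Nat.add_sub_cancel, mul_assoc, ← pow_succ]
      push_cast
      noncomm_ring

lemma pow_mul_sub_mul_pow (h : P * Q - Q * P = 1) (n : ℕ) :
    P ^ n * Q - Q * P ^ n = n * P ^ (n - 1) := by
  -- The pair `(Q, -P)` satisfies the same relation, so the previous lemma applies up to sign.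
  have h' : Q * (-P) - (-P) * Q = 1 := by rw [← h]; noncomm_ring
  have := mul_pow_sub_pow_mul h' n
  rcases n with _ | n
  · simp
  · rw [neg_pow P (n + 1), Nat.add_sub_cancel, neg_pow P n] at this
    rcases Nat.even_or_odd n with hn | hn
    · rw [hn.neg_one_pow, hn.add_one.neg_one_pow] at this
      simp only [Nat.add_sub_cancel]
      rw [one_mul] at this
      rw [← this]; noncomm_ring
    · rw [hn.neg_one_pow, hn.add_one.neg_one_pow] at this
      simp only [Nat.add_sub_cancel]
      have h2 : -(Q * (1 * P ^ (n + 1)) - 1 * P ^ (n + 1) * Q)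
        = -(((n + 1 : ℕ) : R) * (-1 * P ^ n)) := by rw [this]
      calc _ = -(Q * (1 * P ^ (n + 1)) - 1 * P ^ (n + 1) * Q) := by noncomm_ring
        _ = _ := by rw [h2]; noncomm_ring

lemma aeval_mul_sub_mul_aeval (h : P * Q - Q * P = 1) (f : K[X]) :
    aeval P f * Q - Q * aeval P f = aeval P (derivative f) := by
  induction f using Polynomial.induction_on' with
  | add f g hf hg => rw [map_add, map_add, map_add, ← hf, ← hg]; noncomm_ring
  | monomial n c =>
    rw [derivative_monomial, aeval_monomial, aeval_monomial, ← mul_assoc, ← Algebra.commutes c Q,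
      mul_assoc, mul_assoc, ← mul_sub, pow_mul_sub_mul_pow h, map_mul, map_natCast, mul_assoc]

/-- The ordered evaluation `∑ a_s(p) q^s ↦ ∑ a_s(P) Q^s`. -/
noncomputable def orderedEval (K : Type u) [Field K] {R : Type*} [Ring R] [Algebra K R] (P Q : R) :
    K[X][X] →+ R :=
  Polynomial.eval₂AddMonoidHom (aeval P : K[X] →ₐ[K] R).toRingHom Q

lemma orderedEval_monomial (n : ℕ) (a : K[X]) :
    orderedEval K P Q (monomial n a) = aeval P a * Q ^ n := by
  simp [orderedEval, eval₂_monomial]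

lemma orderedEval_C (a : K[X]) : orderedEval K P Q (C a) = aeval P a := by
  simp [orderedEval]

lemma mul_orderedEval_sub (h : P * Q - Q * P = 1) (f : K[X][X]) :
    P * orderedEval K P Q f - orderedEval K P Q f * P = orderedEval K P Q (derivative f) := by
  induction f using Polynomial.induction_on' with
  | add f g hf hg => rw [map_add, map_add, map_add, ← hf, ← hg]; noncomm_ring
  | monomial n a =>
    have hc : P * aeval P a = aeval P a * P := by
      have := congrArg (aeval P) (mul_comm X a)
      simpa using this
    rw [derivative_monomial, orderedEval_monomial, orderedEval_monomial, ← mul_assoc, hc,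
      mul_assoc, mul_assoc, ← mul_sub, mul_pow_sub_pow_mul h, map_mul, map_natCast, mul_assoc]

lemma mul_orderedEval (h : P * Q - Q * P = 1) (f : K[X][X]) :
    ∃ g, Q * orderedEval K P Q f = orderedEval K P Q g := by
  induction f using Polynomial.induction_on' with
  | add f g hf hg =>
    obtain ⟨f', hf⟩ := hf
    obtain ⟨g', hg⟩ := hg
    exact ⟨f' + g', by rw [map_add, map_add, mul_add, hf, hg]⟩
  | monomial n a =>
    refine ⟨monomial (n + 1) a - monomial n (derivative a), ?_⟩
    rw [map_sub, orderedEval_monomial, orderedEval_monomial, orderedEval_monomial,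
      ← aeval_mul_sub_mul_aeval h, pow_succ']
    noncomm_ring

variable [CharZero K] [Nontrivial R]

/-- Commutation with `Q` differentiates `f`, so the relations are stable under derivation; in
characteristic 0 the degree descends to the constants. -/
lemma aeval_eq_zero_of_commutator (h : P * Q - Q * P = 1) (f : K[X]) (hf : aeval P f = 0) :
    f = 0 := by
  induction hn : f.natDegree using Nat.strong_induction_on generalizing f with
  | _ n ih =>
    have hd : aeval P (derivative f) = 0 := by rw [← aeval_mul_sub_mul_aeval h, hf]; simp
    have hd0 : derivative f = 0 := by
      by_contra hne
      have hlt : (derivative f).natDegree < f.natDegree := natDegree_derivative_lt (by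
        intro h0
        exact hne (derivative_of_natDegree_zero h0))
      exact hne (ih _ (hn ▸ hlt) _ hd rfl)
    rw [eq_C_of_natDegree_eq_zero (derivative_eq_zero.1 hd0)] at hf ⊢
    rw [aeval_C] at hf
    rw [(map_eq_zero_iff _ (algebraMap K R).injective).1 hf, C_0]

lemma orderedEval_eq_zero (h : P * Q - Q * P = 1) (f : K[X][X]) (hf : orderedEval K P Q f = 0) :
    f = 0 := by
  induction hn : f.natDegree using Nat.strong_induction_on generalizing f with
  | _ n ih =>
    have hd : orderedEval K P Q (derivative f) = 0 := by rw [← mul_orderedEval_sub h, hf]; simp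
    have hd0 : derivative f = 0 := by
      by_contra hne
      have hlt : (derivative f).natDegree < f.natDegree := natDegree_derivative_lt (by
        intro h0
        exact hne (derivative_of_natDegree_zero h0))
      exact hne (ih _ (hn ▸ hlt) _ hd rfl)
    rw [eq_C_of_natDegree_eq_zero (derivative_eq_zero.1 hd0)] at hf ⊢
    rw [orderedEval_C] at hf
    rw [aeval_eq_zero_of_commutator h _ hf, C_0]

end Commutators

/-! ### Universal property, normal form and centralizer of `p` -/

section WeylAlgebra

variable {K : Type u} [Field K] {R : Type*} [Ring R] [Algebra K R]

lemma p_mul_q_sub : p K * q K - q K * p K = 1 := by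
  have := RingQuot.mkAlgHom_rel K (Rel.comm (K := K))
  rw [map_sub, map_mul, map_mul, map_one] at this
  exact this

/-- The universal property of `A₁`. -/
noncomputable def lift (P Q : R) (h : P * Q - Q * P = 1) : A₁ K →ₐ[K] R :=
  RingQuot.liftAlgHom K ⟨FreeAlgebra.lift K ![P, Q], fun _ _ r => by
    cases r
    simpa using h⟩

lemma lift_p (P Q : R) (h : P * Q - Q * P = 1) : lift P Q h (p K) = P := by
  unfold lift p
  erw [RingQuot.liftAlgHom_mkAlgHom_apply]
  simp

lemma lift_q (P Q : R) (h : P * Q - Q * P = 1) : lift P Q h (q K) = Q := by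
  unfold lift q
  erw [RingQuot.liftAlgHom_mkAlgHom_apply]
  simp

lemma adjoin_p_q : Algebra.adjoin K {p K, q K} = ⊤ := by
  have h1 : (Algebra.adjoin K (Set.range (FreeAlgebra.ι K : Fin 2 → _))).map
      (RingQuot.mkAlgHom K (Rel K)) = ⊤ := by
    rw [FreeAlgebra.adjoin_range_ι, Algebra.map_top]
    exact (AlgHom.range_eq_top _).2 (RingQuot.mkAlgHom_surjective K (Rel K))
  rw [AlgHom.map_adjoin, ← Set.range_comp] at h1
  have hset : Set.range (RingQuot.mkAlgHom K (Rel K) ∘ (FreeAlgebra.ι K : Fin 2 → _))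
      = ({p K, q K} : Set (A₁ K)) := by
    ext x
    constructor
    · rintro ⟨i, rfl⟩
      fin_cases i
      · exact Or.inl rfl
      · exact Or.inr rfl
    · rintro (rfl | rfl)
      · exact ⟨0, rfl⟩
      · exact ⟨1, rfl⟩
  rw [hset] at h1
  exact h1

/-- The range of the ordered evaluation contains 1 and is stable under left multiplication by `p`
and `q`, hence by all of `A₁`. -/
lemma orderedEval_surjective (a : A₁ K) : ∃ f, orderedEval K (p K) (q K) f = a := by
  suffices h : ∀ f : K[X][X], ∃ g, a * orderedEval K (p K) (q K) f
      = orderedEval K (p K) (q K) g by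
    obtain ⟨g, hg⟩ := h (C 1)
    exact ⟨g, by rw [← hg, orderedEval_C, map_one, mul_one]⟩
  have ha : a ∈ Algebra.adjoin K {p K, q K} := by rw [adjoin_p_q]; trivial
  have hC : ∀ (b : K[X]) (f : K[X][X]), ∃ g, aeval (p K) b * orderedEval K (p K) (q K) f
      = orderedEval K (p K) (q K) g := fun b f => ⟨C b * f, by
    induction f using Polynomial.induction_on' with
    | add f g hf hg => rw [map_add, mul_add, mul_add, map_add, hf, hg]
    | monomial n a =>
      rw [C_mul_monomial, orderedEval_monomial, orderedEval_monomial, map_mul, mul_assoc]⟩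
  induction ha using Algebra.adjoin_induction with
  | mem x hx =>
    rcases hx with rfl | rfl
    · intro f
      simpa using hC X f
    · exact mul_orderedEval p_mul_q_sub
  | algebraMap r =>
    intro f
    simpa using hC (C r) f
  | add x y _ _ hx hy =>
    intro f
    obtain ⟨g, hg⟩ := hx f
    obtain ⟨g', hg'⟩ := hy f
    exact ⟨g + g', by rw [add_mul, hg, hg', map_add]⟩
  | mul x y _ _ hx hy =>
    intro f
    obtain ⟨g, hg⟩ := hy f
    obtain ⟨g', hg'⟩ := hx g
    exact ⟨g', by rw [mul_assoc, hg, hg']⟩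

lemma map_orderedEval (φ : A₁ K →ₐ[K] R) (f : K[X][X]) :
    φ (orderedEval K (p K) (q K) f) = orderedEval K (φ (p K)) (φ (q K)) f := by
  induction f using Polynomial.induction_on' with
  | add f g hf hg => simp only [map_add, hf, hg]
  | monomial n a =>
    rw [orderedEval_monomial, orderedEval_monomial, map_mul, map_pow, aeval_algHom_apply]

variable [CharZero K]

/-- Every algebra homomorphism from `A₁` to a nontrivial algebra is injective. -/
lemma algHom_injective [Nontrivial R] (φ : A₁ K →ₐ[K] R) : Function.Injective φ := by
  refine (injective_iff_map_eq_zero φ).2 fun a ha => ?_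
  obtain ⟨f, rfl⟩ := orderedEval_surjective a
  rw [map_orderedEval] at ha
  rw [orderedEval_eq_zero _ f ha, map_zero]
  rw [← map_mul, ← map_mul, ← map_sub, p_mul_q_sub, map_one]

/-- The centralizer of `p` is `K[p]`. -/
lemma exists_aeval_of_commute [Nontrivial (A₁ K)] {a : A₁ K} (h : p K * a - a * p K = 0) :
    ∃ f : K[X], a = aeval (p K) f := by
  obtain ⟨f, rfl⟩ := orderedEval_surjective a
  rw [mul_orderedEval_sub p_mul_q_sub] at h
  have hd := orderedEval_eq_zero p_mul_q_sub _ h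
  refine ⟨f.coeff 0, ?_⟩
  rw [← orderedEval_C (Q := q K),
    ← eq_C_of_natDegree_eq_zero (derivative_eq_zero.1 hd)]

end WeylAlgebra

/-! ### Leading coefficients of skew commutators in `K[X]` -/

section Polynomials

variable {K : Type u} [Field K]

lemma coeff_mul_of_natDegree_le_succ {u v : K[X]} {d e : ℕ} (hu : u.natDegree ≤ d + 1)
    (hv : v.natDegree ≤ e + 1) :
    (u * v).coeff (d + e + 1) = u.coeff d * v.coeff (e + 1) + u.coeff (d + 1) * v.coeff e := by
  rw [coeff_mul, ← Finset.sum_pair (f := fun x : ℕ × ℕ => u.coeff x.1 * v.coeff x.2)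
    (a := (d, e + 1)) (b := (d + 1, e)) (by simp)]
  symm
  refine Finset.sum_subset ?_ ?_
  · intro x hx
    simp only [Finset.mem_insert, Finset.mem_singleton] at hx
    rcases hx with rfl | rfl <;> simp [Finset.HasAntidiagonal.mem_antidiagonal] <;> omega
  · rintro ⟨a, b⟩ hx hne
    simp only [Finset.HasAntidiagonal.mem_antidiagonal, Finset.mem_insert, Finset.mem_singleton, Prod.mk.injEq,
      not_or] at hx hne
    by_cases ha : d + 1 < a
    · rw [coeff_eq_zero_of_natDegree_lt (hu.trans_lt ha), zero_mul]
    · rw [coeff_eq_zero_of_natDegree_lt (p := v) (by omega), mul_zero]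

lemma coeff_taylor_of_natDegree_le {g : K[X]} {e : ℕ} (hg : g.natDegree ≤ e) (x : K) :
    (taylor x g).coeff e = g.coeff e := by
  rcases hg.lt_or_eq with h | h
  · rw [coeff_eq_zero_of_natDegree_lt h,
      coeff_eq_zero_of_natDegree_lt (by rwa [natDegree_taylor])]
  · subst h
    rw [coeff_taylor_natDegree, coeff_natDegree]

lemma coeff_taylor_of_natDegree_le_succ {g : K[X]} {e : ℕ} (hg : g.natDegree ≤ e + 1) (x : K) :
    (taylor x g).coeff e = g.coeff e + (e + 1) * x * g.coeff (e + 1) := by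
  have hd : (hasseDeriv e g).natDegree < 2 := by
    have := natDegree_hasseDeriv_le g e
    omega
  rw [taylor_coeff, eval_eq_sum_range' hd]
  simp [Finset.sum_range_succ, hasseDeriv_coeff, add_comm 1 e]
  ring

/-- The leading coefficient of a skew commutator of two polynomials. -/
lemma coeff_skewCommutator {f g : K[X]} {d e : ℕ} (hf : f.natDegree ≤ d) (hg : g.natDegree ≤ e)
    (hde : 0 < d + e) (x y : K) :
    (f * taylor x g - g * taylor y f).coeff (d + e - 1)
      = (e * x - d * y) * (f.coeff d * g.coeff e) := by
  have hf' (y : K) : (taylor y f).natDegree ≤ d := by rwa [natDegree_taylor]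
  have hg' (x : K) : (taylor x g).natDegree ≤ e := by rwa [natDegree_taylor]
  rcases d with _ | d
  · rcases e with _ | e
    · omega
    · rw [eq_C_of_natDegree_le_zero hf, taylor_C, mul_comm g, ← mul_sub, coeff_C_mul, coeff_sub]
      simp only [zero_add, Nat.add_sub_cancel]
      rw [coeff_taylor_of_natDegree_le_succ hg]
      simp
      ring
  · rcases e with _ | e
    · rw [eq_C_of_natDegree_le_zero hg, taylor_C, mul_comm f, ← mul_sub, coeff_C_mul, coeff_sub]
      simp only [add_zero, Nat.add_sub_cancel]
      rw [coeff_taylor_of_natDegree_le_succ hf]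
      simp
      ring
    · rw [coeff_sub, mul_comm g, show d + 1 + (e + 1) - 1 = d + e + 1 by omega,
        coeff_mul_of_natDegree_le_succ hf (hg' x), coeff_mul_of_natDegree_le_succ (hf' y) hg,
        coeff_taylor_of_natDegree_le hf, coeff_taylor_of_natDegree_le hg,
        coeff_taylor_of_natDegree_le_succ hf, coeff_taylor_of_natDegree_le_succ hg]
      push_cast
      ring

/-- Translation preserves leading coefficients, so the two products cancel at the top. -/
lemma coeff_skewCommutator_eq_zero {f g : K[X]} {n : ℕ} (h : f.natDegree + g.natDegree ≤ n)
    (x y : K) : (f * taylor x g - g * taylor y f).coeff n = 0 := by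
  obtain ⟨e, rfl⟩ := Nat.exists_eq_add_of_le (Nat.le_of_add_right_le h)
  have he : g.natDegree ≤ e := by omega
  rw [coeff_sub, mul_comm g, coeff_mul_add_eq_of_natDegree_le le_rfl (by rwa [natDegree_taylor]),
    coeff_mul_add_eq_of_natDegree_le (by rw [natDegree_taylor]) he,
    coeff_taylor_of_natDegree_le le_rfl, coeff_taylor_of_natDegree_le he, sub_self]

/-- The action of `ℤ` on `K[X]` by translations. -/
noncomputable instance translationAction : MulSemiringAction (Multiplicative ℤ) K[X] where
  smul n f := taylor ((Multiplicative.toAdd n : ℤ) : K) f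
  one_smul f := by
    change taylor (((0 : ℤ)) : K) f = f
    simp
  mul_smul m n f := by
    change taylor (((Multiplicative.toAdd m + Multiplicative.toAdd n : ℤ)) : K) f
      = taylor _ (taylor _ f)
    rw [taylor_taylor]
    push_cast
    rfl
  smul_zero _ := map_zero _
  smul_add _ := map_add _
  smul_one _ := by
    change taylor _ 1 = 1
    rw [taylor_one, C_1]
  smul_mul _ _ _ := taylor_mul _ _ _

lemma translation_smul (n : Multiplicative ℤ) (f : K[X]) :
    n • f = taylor ((Multiplicative.toAdd n : ℤ) : K) f := rfl

instance : SMulCommClass (Multiplicative ℤ) K K[X] where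
  smul_comm n c f := by simp only [translation_smul, map_smul]

end Polynomials

/-! ### Coefficients and commutators of skew Laurent polynomials -/

/-- The skew Laurent polynomial ring over `K[X]` with `T f(X) = f(X + 1) T`. -/
abbrev SkewLaurent (K : Type u) [Field K] : Type u := SkewMonoidAlgebra K[X] (Multiplicative ℤ)

namespace SkewLaurent

variable {K : Type u} [Field K]

/-- The coefficient of `T ^ k`. -/
noncomputable def cf (F : SkewLaurent K) (k : ℤ) : K[X] := F.coeff (Multiplicative.ofAdd k)

@[simp] lemma cf_add (F G : SkewLaurent K) (k : ℤ) : cf (F + G) k = cf F k + cf G k := by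
  simp [cf]

@[simp] lemma cf_sub (F G : SkewLaurent K) (k : ℤ) : cf (F - G) k = cf F k - cf G k := by
  simp [cf]

@[simp] lemma cf_smul (c : K) (F : SkewLaurent K) (k : ℤ) : cf (c • F) k = c • cf F k := by
  simp [cf]

@[simp] lemma cf_zero (k : ℤ) : cf (0 : SkewLaurent K) k = 0 := by
  simp [cf]

lemma cf_single (m k : ℤ) (f : K[X]) :
    cf (SkewMonoidAlgebra.single (Multiplicative.ofAdd m) f) k = if m = k then f else 0 := by
  classical
  rw [cf, SkewMonoidAlgebra.coeff_single_apply]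
  simp

lemma cf_one (k : ℤ) : cf (1 : SkewLaurent K) k = if 0 = k then 1 else 0 := by
  rw [← cf_single]; rfl

lemma cf_algebraMap (c : K) (k : ℤ) :
    cf (algebraMap K (SkewLaurent K) c) k = if 0 = k then C c else 0 := by
  rw [Algebra.algebraMap_eq_smul_one, cf_smul, cf_one]
  split_ifs <;> simp [smul_eq_C_mul]

@[ext] lemma ext_cf {F G : SkewLaurent K} (h : ∀ k, cf F k = cf G k) : F = G :=
  SkewMonoidAlgebra.ext fun k => h (Multiplicative.toAdd k)

lemma single_mul_single (m n : ℤ) (f g : K[X]) :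
    (SkewMonoidAlgebra.single (Multiplicative.ofAdd m) f : SkewLaurent K) *
      SkewMonoidAlgebra.single (Multiplicative.ofAdd n) g
      = SkewMonoidAlgebra.single (Multiplicative.ofAdd (m + n)) (f * taylor (m : K) g) := by
  rw [SkewMonoidAlgebra.single_mul_single]; rfl

/-- The support, as a set of integers. -/
noncomputable def degrees (F : SkewLaurent K) : Finset ℤ :=
  F.support.map Multiplicative.toAdd.toEmbedding

lemma mem_degrees {F : SkewLaurent K} {k : ℤ} : k ∈ degrees F ↔ cf F k ≠ 0 := by
  simp [degrees, cf, SkewMonoidAlgebra.mem_support_iff]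

lemma cf_mul (F G : SkewLaurent K) (n : ℤ) :
    cf (F * G) n = ∑ k ∈ degrees F, ∑ l ∈ degrees G,
      if k + l = n then cf F k * taylor (k : K) (cf G l) else 0 := by
  classical
  rw [cf, SkewMonoidAlgebra.coeff_mul]
  simp only [degrees, Finset.sum_map]
  rfl

lemma cf_commutator (F G : SkewLaurent K) (n : ℤ) :
    cf (F * G - G * F) n = ∑ k ∈ degrees F, ∑ l ∈ degrees G,
      if k + l = n then cf F k * taylor (k : K) (cf G l) - cf G l * taylor (l : K) (cf F k)
      else 0 := by
  rw [cf_sub, cf_mul, cf_mul, Finset.sum_comm (s := degrees G), ← Finset.sum_sub_distrib]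
  refine Finset.sum_congr rfl fun k _ => ?_
  rw [← Finset.sum_sub_distrib]
  refine Finset.sum_congr rfl fun l _ => ?_
  rw [add_comm l k]
  split_ifs <;> simp

/-- The coefficient of a commutator at an extremal position. -/
lemma coeff_cf_commutator {F G : SkewLaurent K} {k₀ l₀ : ℤ} {d e : ℕ} (hde : 0 < d + e)
    (hF : (cf F k₀).natDegree ≤ d) (hG : (cf G l₀).natDegree ≤ e)
    (h : ∀ k l, cf F k ≠ 0 → cf G l ≠ 0 → k + l = k₀ + l₀ → k ≠ k₀ →
      (cf F k).natDegree + (cf G l).natDegree < d + e) :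
    (cf (F * G - G * F) (k₀ + l₀)).coeff (d + e - 1)
      = (e * k₀ - d * l₀) * ((cf F k₀).coeff d * (cf G l₀).coeff e) := by
  rw [cf_commutator, finsetSum_coeff]
  simp only [finsetSum_coeff]
  rw [Finset.sum_eq_single k₀, Finset.sum_eq_single l₀]
  · rw [if_pos rfl, coeff_skewCommutator hF hG hde]
  · intro l _ hl
    rw [if_neg (by simpa using hl), coeff_zero]
  · intro hl
    rw [mem_degrees, not_not] at hl
    simp [hl]
  · intro k hk hne
    refine Finset.sum_eq_zero fun l hl => ?_
    split_ifs with hkl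
    · have := h k l (mem_degrees.1 hk) (mem_degrees.1 hl) hkl hne
      exact coeff_skewCommutator_eq_zero (by omega) _ _
    · simp
  · intro hk
    rw [mem_degrees, not_not] at hk
    simp [hk]

end SkewLaurent

/-! ### Extremal terms of a pair with commutator 1 -/

namespace SkewLaurent

variable {K : Type u} [Field K]

lemma cf_commutator_eq {F G : SkewLaurent K} {k₀ l₀ : ℤ}
    (h : ∀ k l, cf F k ≠ 0 → cf G l ≠ 0 → k + l = k₀ + l₀ → k = k₀) :
    cf (F * G - G * F) (k₀ + l₀)
      = cf F k₀ * taylor (k₀ : K) (cf G l₀) - cf G l₀ * taylor (l₀ : K) (cf F k₀) := by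
  rw [cf_commutator, Finset.sum_eq_single k₀, Finset.sum_eq_single l₀, if_pos rfl]
  · intro l _ hl
    rw [if_neg (by simpa using hl)]
  · intro hl
    rw [mem_degrees, not_not] at hl
    simp [hl]
  · intro k hk hne
    refine Finset.sum_eq_zero fun l hl => if_neg fun hkl => ?_
    exact hne (h k l (mem_degrees.1 hk) (mem_degrees.1 hl) hkl)
  · intro hk
    rw [mem_degrees, not_not] at hk
    simp [hk]

lemma exists_min_degree {F : SkewLaurent K} (h : F ≠ 0) :
    ∃ k, cf F k ≠ 0 ∧ ∀ l, cf F l ≠ 0 → k ≤ l := by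
  have hne : (degrees F).Nonempty := by
    by_contra hne
    rw [Finset.not_nonempty_iff_eq_empty] at hne
    refine h (ext_cf fun k => ?_)
    by_contra hk
    rw [cf_zero] at hk
    simpa [hne] using mem_degrees.2 hk
  exact ⟨(degrees F).min' hne, mem_degrees.1 (Finset.min'_mem _ _),
    fun l hl => Finset.min'_le _ _ (mem_degrees.2 hl)⟩

variable {F G : SkewLaurent K}

lemma left_ne_zero_of_commutator (h : F * G - G * F = 1) : F ≠ 0 := by
  rintro rfl
  simp at h

lemma right_ne_zero_of_commutator (h : F * G - G * F = 1) : G ≠ 0 := by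
  rintro rfl
  simp at h

variable [CharZero K]

/-- Write `f` for the `T⁰` coefficient of `F` and `g T^l₀` for the lowest term of `G`. The
commutator has `g (f - f(X + l₀))` at `T^l₀`. For `l₀ = 0` this vanishes instead of being 1; for `l₀
≠ 0` it must vanish, which forces `f` to be constant. -/
lemma natDegree_cf_zero_of_commutator (h : F * G - G * F = 1) (hF : ∀ k < 0, cf F k = 0) :
    (cf F 0).natDegree = 0 := by
  by_contra hd
  obtain ⟨l₀, hl₀, hmin⟩ := exists_min_degree (right_ne_zero_of_commutator h)
  have hpair : ∀ k l, cf F k ≠ 0 → cf G l ≠ 0 → k + l = 0 + l₀ → k = 0 := by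
    intro k l hk hl hkl
    have := hmin l hl
    have : ¬ k < 0 := fun hk' => hk (hF k hk')
    omega
  have key := cf_commutator_eq hpair
  rw [h] at key
  have hF0 : cf F 0 ≠ 0 := fun h0 => hd (by rw [h0, natDegree_zero])
  by_cases hl : l₀ = 0
  · subst hl
    rw [cf_one] at key
    simp [mul_comm] at key
  · rw [cf_one, if_neg (by omega)] at key
    have := coeff_skewCommutator (f := cf F 0) (g := cf G l₀) le_rfl le_rfl (by omega)
      ((0 : ℤ) : K) (l₀ : K)
    rw [← key, coeff_zero] at this
    simp [hl, hd, hF0, hl₀] at this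

/-- If `[F, G] = 1` and `F` has only positive degrees, then the initial terms of `F` and `G`
look like those of `p` and `q`. -/
lemma initial_terms_of_commutator (h : F * G - G * F = 1) (hF : ∀ k ≤ 0, cf F k = 0)
    (hG : ∀ k < 0, cf G k ≠ 0 → -k ≤ (cf G k).natDegree) :
    cf F 1 ≠ 0 ∧ (cf F 1).natDegree = 0 ∧ cf G (-1) ≠ 0 ∧ (cf G (-1)).natDegree = 1 ∧
      ∀ l < -1, cf G l = 0 := by
  obtain ⟨k₀, hk₀, hkmin⟩ := exists_min_degree (left_ne_zero_of_commutator h)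
  obtain ⟨l₀, hl₀, hlmin⟩ := exists_min_degree (right_ne_zero_of_commutator h)
  have hk₀pos : 0 < k₀ := by
    by_contra hk
    exact hk₀ (hF k₀ (by omega))
  have hl₀neg : l₀ < 0 := by
    by_contra hl
    have h0 : cf (F * G - G * F) 0 = 0 := by
      rw [cf_commutator]
      refine Finset.sum_eq_zero fun k hk => Finset.sum_eq_zero fun l hl => if_neg ?_
      have := hkmin k (mem_degrees.1 hk)
      have := hlmin l (mem_degrees.1 hl)
      omega
    rw [h, cf_one] at h0
    simp at h0
  have he := hG l₀ hl₀neg hl₀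
  have key := cf_commutator_eq (F := F) (G := G) (k₀ := k₀) (l₀ := l₀) (by
    intro k l hk hl hkl
    have := hkmin k hk
    have := hlmin l hl
    omega)
  have hc := coeff_skewCommutator (f := cf F k₀) (g := cf G l₀) le_rfl le_rfl (by omega)
      (k₀ : K) (l₀ : K)
  rw [← key, h, cf_one] at hc
  -- The bound `he` makes the degree of `cf G l₀` positive, so the leading coefficients of the
  -- lowest terms do not cancel.
  have hpos : 0 < ((cf G l₀).natDegree : ℤ) * k₀ - (cf F k₀).natDegree * l₀ := by
    have h1 : 0 < ((cf G l₀).natDegree : ℤ) * k₀ := mul_pos (by omega) hk₀pos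
    have h2 : ((cf F k₀).natDegree : ℤ) * l₀ ≤ 0 :=
      mul_nonpos_of_nonneg_of_nonpos (by omega) hl₀neg.le
    omega
  have hne : (((cf G l₀).natDegree : K) * k₀ - (cf F k₀).natDegree * l₀)
      * ((cf F k₀).leadingCoeff * (cf G l₀).leadingCoeff) ≠ 0 := by
    refine mul_ne_zero ?_ (mul_ne_zero (leadingCoeff_ne_zero.2 hk₀) (leadingCoeff_ne_zero.2 hl₀))
    exact_mod_cast hpos.ne'
  rw [coeff_natDegree, coeff_natDegree] at hc
  rw [← hc] at hne
  split_ifs at hne with hkl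
  · rw [coeff_one] at hne
    have hdeg : (cf F k₀).natDegree + (cf G l₀).natDegree - 1 = 0 := by
      by_contra hdeg
      exact hne (if_neg hdeg)
    -- Now `k₀ + l₀ = 0` and the two degrees sum to at most 1, while `he` bounds the degree of `cf G
    -- l₀` below by `-l₀ ≥ 1`.
    obtain rfl : l₀ = -1 := by omega
    obtain rfl : k₀ = 1 := by omega
    refine ⟨hk₀, by omega, hl₀, by omega, fun l hl => ?_⟩
    by_contra hl'
    have := hlmin l hl'
    omega
  · simp at hne

/-- If `[F, G] = 1` and the initial terms of `F` and `G` look like those of `p` and `q`, then `F`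
has no other terms. -/
lemma cf_eq_zero_of_commutator (h : F * G - G * F = 1) (hF : ∀ k ≤ 0, cf F k = 0)
    (hF1 : cf F 1 ≠ 0) (hF1' : (cf F 1).natDegree = 0) (hG1 : cf G (-1) ≠ 0)
    (hG1' : (cf G (-1)).natDegree = 1) (hG : ∀ l < -1, cf G l = 0) (k : ℤ) (hk : k ≠ 1) :
    cf F k = 0 := by
  classical
  by_contra hFk
  have hFpos : ∀ k, cf F k ≠ 0 → 1 ≤ k := fun k hk => by
    by_contra hk'
    exact hk (hF k (by omega))
  have hGpos : ∀ l, cf G l ≠ 0 → -1 ≤ l := fun l hl => by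
    by_contra hl'
    exact hl (hG l (by omega))
  -- Slopes in the (`T`-exponent, `X`-degree) plane, measured from the initial points `(1, 0)` of
  -- `F` and `(-1, 1)` of `G`.
  let sF : ℤ → ℚ := fun k => ((cf F k).natDegree : ℚ) / (k - 1)
  let sG : ℤ → ℚ := fun l => (((cf G l).natDegree : ℚ) - 1) / (l + 1)
  let S : Finset ℚ := ((degrees F).erase 1).image sF ∪ ((degrees G).erase (-1)).image sG
  have hkS : sF k ∈ S := Finset.mem_union_left _ (Finset.mem_image_of_mem _
    (Finset.mem_erase.2 ⟨hk, mem_degrees.2 hFk⟩))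
  obtain ⟨τ, hτ, hmax⟩ : ∃ τ ∈ S, ∀ x ∈ S, x ≤ τ :=
    ⟨S.max' ⟨_, hkS⟩, S.max'_mem _, fun x hx => S.le_max' x hx⟩
  have hsub (k : ℤ) (hk : 1 ≤ k) (hk1 : k ≠ 1) : (0 : ℚ) < k - 1 := by
    have : (1 : ℚ) < k := by exact_mod_cast lt_of_le_of_ne hk (Ne.symm hk1)
    linarith
  have hadd (l : ℤ) (hl : -1 ≤ l) (hl1 : l ≠ -1) : (0 : ℚ) < l + 1 := by
    have : ((-1 : ℤ) : ℚ) < l := by exact_mod_cast lt_of_le_of_ne hl (Ne.symm hl1)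
    push_cast at this
    linarith
  have hτ0 : 0 ≤ τ :=
    (div_nonneg (Nat.cast_nonneg _) (hsub k (hFpos k hFk) hk).le).trans (hmax _ hkS)
  have hFle (k : ℤ) (hk : cf F k ≠ 0) : ((cf F k).natDegree : ℚ) ≤ τ * (k - 1) := by
    by_cases hk1 : k = 1
    · subst hk1
      simp [hF1']
    · rw [← div_le_iff₀ (hsub k (hFpos k hk) hk1)]
      exact hmax _ (Finset.mem_union_left _ (Finset.mem_image_of_mem sF
        (Finset.mem_erase.2 ⟨hk1, mem_degrees.2 hk⟩)))
  have hGle (l : ℤ) (hl : cf G l ≠ 0) : ((cf G l).natDegree : ℚ) ≤ 1 + τ * (l + 1) := by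
    by_cases hl1 : l = -1
    · subst hl1
      simp [hG1']
    · have : sG l ≤ τ := hmax _ (Finset.mem_union_right _ (Finset.mem_image_of_mem sG
        (Finset.mem_erase.2 ⟨hl1, mem_degrees.2 hl⟩)))
      rw [div_le_iff₀ (hadd l (hGpos l hl) hl1)] at this
      linarith
  let EF := (degrees F).filter fun k => ((cf F k).natDegree : ℚ) = τ * (k - 1)
  let EG := (degrees G).filter fun l => ((cf G l).natDegree : ℚ) = 1 + τ * (l + 1)
  have hEF1 : (1 : ℤ) ∈ EF := Finset.mem_filter.2 ⟨mem_degrees.2 hF1, by simp [hF1']⟩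
  have hEG1 : (-1 : ℤ) ∈ EG := Finset.mem_filter.2 ⟨mem_degrees.2 hG1, by simp [hG1']⟩
  -- Rightmost points on the two lines of maximal slope `τ`.
  obtain ⟨k₀, hk₀, hk₀max⟩ : ∃ k ∈ EF, ∀ x ∈ EF, x ≤ k :=
    ⟨EF.max' ⟨_, hEF1⟩, EF.max'_mem _, fun x hx => EF.le_max' x hx⟩
  obtain ⟨l₀, hl₀, hl₀max⟩ : ∃ l ∈ EG, ∀ x ∈ EG, x ≤ l :=
    ⟨EG.max' ⟨_, hEG1⟩, EG.max'_mem _, fun x hx => EG.le_max' x hx⟩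
  have hk₀1 := hk₀max 1 hEF1
  have hl₀1 := hl₀max (-1) hEG1
  -- The slope `τ` is attained away from an initial point, so `k₀ > 1` or `l₀ > -1`.
  have hsum : 0 < k₀ + l₀ := by
    rcases Finset.mem_union.1 hτ with hτ | hτ
    · obtain ⟨k, hk, hkτ⟩ := Finset.mem_image.1 hτ
      obtain ⟨hk1, hkF⟩ := Finset.mem_erase.1 hk
      have hk' := hFpos k (mem_degrees.1 hkF)
      have := hk₀max k (Finset.mem_filter.2
        ⟨hkF, ((div_eq_iff (hsub k hk' hk1).ne').1 hkτ)⟩)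
      omega
    · obtain ⟨l, hl, hlτ⟩ := Finset.mem_image.1 hτ
      obtain ⟨hl1, hlG⟩ := Finset.mem_erase.1 hl
      have hl' := hGpos l (mem_degrees.1 hlG)
      have := hl₀max l (Finset.mem_filter.2
        ⟨hlG, by linarith [(div_eq_iff (hadd l hl' hl1).ne').1 hlτ]⟩)
      omega
  obtain ⟨hk₀F, hk₀d⟩ := Finset.mem_filter.1 hk₀
  obtain ⟨hl₀G, hl₀e⟩ := Finset.mem_filter.1 hl₀
  rw [mem_degrees] at hk₀F hl₀G
  have hl₀1' : (-1 : ℚ) ≤ l₀ := by exact_mod_cast hl₀1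
  have hk₀1' : (1 : ℚ) ≤ k₀ := by exact_mod_cast hk₀1
  have he : 1 ≤ (cf G l₀).natDegree := by
    have : (1 : ℚ) ≤ (cf G l₀).natDegree := by
      rw [hl₀e]
      have := mul_nonneg hτ0 (by linarith : (0 : ℚ) ≤ l₀ + 1)
      linarith
    exact_mod_cast this
  -- Degrees of a pair sum to at most `1 + τ (k + l)`. Equality puts both points on the lines,
  -- whence `k ≤ k₀` and `l ≤ l₀`; a fixed sum then leaves only `(k₀, l₀)`.
  have hc := coeff_cf_commutator (F := F) (G := G) (k₀ := k₀) (l₀ := l₀) (by omega) le_rfl le_rfl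
    (by
      intro k l hk hl hkl hne
      have h1 := hFle k hk
      have h2 := hGle l hl
      have hkl' : (k : ℚ) + l = k₀ + l₀ := by exact_mod_cast hkl
      have hτkl : τ * k + τ * l = τ * k₀ + τ * l₀ := by rw [← mul_add, hkl', mul_add]
      by_contra hlt
      have hlt' : ((cf F k₀).natDegree : ℚ) + (cf G l₀).natDegree
          ≤ (cf F k).natDegree + (cf G l).natDegree := by exact_mod_cast not_lt.1 hlt
      have := hk₀max k (Finset.mem_filter.2 ⟨mem_degrees.2 hk, by linarith⟩)
      have := hl₀max l (Finset.mem_filter.2 ⟨mem_degrees.2 hl, by linarith⟩)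
      omega)
  rw [h, cf_one, if_neg (by omega), coeff_zero, coeff_natDegree, coeff_natDegree] at hc
  refine mul_ne_zero ?_ (mul_ne_zero (leadingCoeff_ne_zero.2 hk₀F)
    (leadingCoeff_ne_zero.2 hl₀G)) hc.symm
  -- On the two lines this expression equals `k₀ + τ (k₀ + l₀)`.
  have hpos : (0 : ℚ) < (cf G l₀).natDegree * k₀ - (cf F k₀).natDegree * l₀ := by
    have hsum' : (0 : ℚ) < k₀ + l₀ := by exact_mod_cast hsum
    have := mul_nonneg hτ0 hsum'.le
    rw [hl₀e, hk₀d]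
    linarith
  have hpos' : (0 : ℤ) < (cf G l₀).natDegree * k₀ - (cf F k₀).natDegree * l₀ := by
    exact_mod_cast hpos
  exact_mod_cast hpos'.ne'

end SkewLaurent

open SkewLaurent

/-! ### Embedding of `A₁` and the affine form of `z` -/

section Representation

variable {K : Type u} [Field K]

/-- The embedding of `A₁` into the skew Laurent polynomial ring, `p ↦ T`, `q ↦ X T⁻¹`. -/
noncomputable def toSkewLaurent : A₁ K →ₐ[K] SkewLaurent K :=
  lift (SkewMonoidAlgebra.single (Multiplicative.ofAdd 1) 1)
    (SkewMonoidAlgebra.single (Multiplicative.ofAdd (-1)) X) (by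
      rw [single_mul_single, single_mul_single]
      ext k : 1
      simp only [cf_sub, cf_single, cf_one]
      norm_num
      split_ifs <;> simp)

lemma toSkewLaurent_p : toSkewLaurent (p K)
    = SkewMonoidAlgebra.single (Multiplicative.ofAdd 1) 1 := lift_p ..

lemma toSkewLaurent_q : toSkewLaurent (q K)
    = SkewMonoidAlgebra.single (Multiplicative.ofAdd (-1)) X := lift_q ..

instance : Nontrivial (A₁ K) := (toSkewLaurent (K := K)).toRingHom.domain_nontrivial

lemma toSkewLaurent_p_pow (i : ℕ) : toSkewLaurent (p K ^ i)
    = SkewMonoidAlgebra.single (Multiplicative.ofAdd (i : ℤ)) 1 := by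
  induction i with
  | zero => rw [pow_zero, map_one]; rfl
  | succ i ih =>
    rw [pow_succ, map_mul, ih, toSkewLaurent_p, single_mul_single, taylor_one]
    simp

lemma exists_toSkewLaurent_q_pow (s : ℕ) : ∃ f : K[X], toSkewLaurent (q K ^ s)
    = SkewMonoidAlgebra.single (Multiplicative.ofAdd (-(s : ℤ))) f := by
  induction s with
  | zero => exact ⟨1, by rw [pow_zero, map_one]; rfl⟩
  | succ s ih =>
    obtain ⟨f, hf⟩ := ih
    refine ⟨f * taylor ((-(s : ℤ) : ℤ) : K) X, ?_⟩
    rw [pow_succ, map_mul, hf, toSkewLaurent_q, single_mul_single]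
    congr 2
    push_cast
    ring

/-- The embedding reverses the grading: `p ^ i * q ^ s` has `T`-exponent `i - s`. -/
lemma cf_toSkewLaurent_of_mem_DLe {a : A₁ K} (ha : a ∈ DLe K 0) (k : ℤ) (hk : k < 0) :
    cf (toSkewLaurent a) k = 0 := by
  let V : Submodule K (A₁ K) :=
    { carrier := {a | cf (toSkewLaurent a) k = 0}
      add_mem' := fun {a b} ha hb => by
        simp only [Set.mem_ofPred_eq] at ha hb ⊢
        rw [map_add, cf_add, ha, hb, add_zero]
      zero_mem' := by simp
      smul_mem' := fun c a ha => by
        simp only [Set.mem_ofPred_eq] at ha ⊢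
        rw [map_smul, cf_smul, ha, smul_zero] }
  have hV : DLe K 0 ≤ V := by
    refine iSup_le fun t => iSup_le fun ht => Submodule.span_le.2 ?_
    rintro _ ⟨i, s, hst, rfl⟩
    obtain ⟨f, hf⟩ := exists_toSkewLaurent_q_pow (K := K) s
    change cf (toSkewLaurent (p K ^ i * q K ^ s)) k = 0
    rw [map_mul, toSkewLaurent_p_pow, hf, single_mul_single, cf_single, if_neg (by omega)]
  exact hV ha

/-- The property is multiplicative: the product of `f T^i` and `g T^j` has coefficient `f(X) g(X +
i)`. At `m` the first factor vanishes if `m + i < 0`; otherwise `m + i` is a natural number at which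
`g` vanishes. -/
lemma eval_cf_toSkewLaurent (a : A₁ K) (k : ℤ) (m : ℕ) (hm : m + k < 0) :
    (cf (toSkewLaurent a) k).eval (m : K) = 0 := by
  have ha : a ∈ Algebra.adjoin K {p K, q K} := by rw [adjoin_p_q]; trivial
  induction ha using Algebra.adjoin_induction generalizing k m with
  | mem x hx =>
    rcases hx with rfl | rfl
    · rw [toSkewLaurent_p, cf_single, if_neg (by omega), eval_zero]
    · rw [toSkewLaurent_q, cf_single]
      split_ifs with h
      · obtain rfl : m = 0 := by omega
        simp
      · simp
  | algebraMap r =>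
    rw [AlgHom.commutes, cf_algebraMap, if_neg (by omega), eval_zero]
  | add x y _ _ hx hy => rw [map_add, cf_add, eval_add, hx k m hm, hy k m hm, add_zero]
  | mul x y _ _ hx hy =>
    rw [map_mul, cf_mul, eval_finsetSum]
    refine Finset.sum_eq_zero fun i _ => ?_
    rw [eval_finsetSum]
    refine Finset.sum_eq_zero fun j _ => ?_
    split_ifs with hij
    · rw [eval_mul, taylor_eval]
      by_cases hi : m + i < 0
      · rw [hx i m hi, zero_mul]
      · obtain ⟨n, hn⟩ := Int.eq_ofNat_of_zero_le (not_lt.1 hi)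
        have hn' : (m : K) + i = n := by exact_mod_cast congrArg (Int.cast : ℤ → K) hn
        rw [hn', hy j n (by omega), mul_zero]
    · exact eval_zero

variable [CharZero K]

/-- For `k < 0` the coefficient has the roots `0, …, -k - 1`, distinct in characteristic 0. -/
lemma neg_le_natDegree_cf_toSkewLaurent (a : A₁ K) (k : ℤ) (h : cf (toSkewLaurent a) k ≠ 0) :
    -k ≤ (cf (toSkewLaurent a) k).natDegree := by
  by_contra hlt
  refine h (eq_zero_of_natDegree_lt_card_of_eval_eq_zero' _
    ((Finset.range (-k).toNat).map Nat.castEmbedding) ?_ ?_)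
  · intro x hx
    obtain ⟨m, hm, rfl⟩ := Finset.mem_map.1 hx
    rw [Finset.mem_range] at hm
    exact eval_cf_toSkewLaurent a k m (by omega)
  · rw [Finset.card_map, Finset.card_range]
    omega

/-- An element of `D_{≤ 0}` which is part of a canonical pair is affine in `p`. -/
theorem eq_affine_of_mem_DLe {z w : A₁ K} (hz : z ∈ DLe K 0) (h : z * w - w * z = 1) :
    ∃ a c : K, a ≠ 0 ∧ z = algebraMap K _ c + a • p K := by
  have hF := cf_toSkewLaurent_of_mem_DLe hz
  have hzw : toSkewLaurent z * toSkewLaurent w - toSkewLaurent w * toSkewLaurent z = 1 := by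
    rw [← map_mul, ← map_mul, ← map_sub, h, map_one]
  have h0 := eq_C_of_natDegree_eq_zero (natDegree_cf_zero_of_commutator hzw hF)
  set c := (cf (toSkewLaurent z) 0).coeff 0
  set F := toSkewLaurent z - algebraMap K _ c with hFdef
  have hF' : ∀ k ≤ 0, cf F k = 0 := by
    intro k hk
    rw [hFdef, cf_sub, cf_algebraMap]
    rcases hk.lt_or_eq with hk | rfl
    · rw [hF k hk, if_neg (by omega), sub_zero]
    · rw [if_pos rfl, h0, sub_self]
  have hFw : F * toSkewLaurent w - toSkewLaurent w * F = 1 := by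
    rw [← hzw, hFdef, sub_mul, mul_sub, Algebra.commutes c]
    abel
  obtain ⟨h1, h2, h3, h4, h5⟩ := initial_terms_of_commutator hFw hF'
    fun k _ => neg_le_natDegree_cf_toSkewLaurent w k
  have h6 := cf_eq_zero_of_commutator hFw hF' h1 h2 h3 h4 h5
  rw [eq_C_of_natDegree_eq_zero h2] at h1
  refine ⟨(cf F 1).coeff 0, c, fun h => h1 (by rw [h, C_0]), algHom_injective toSkewLaurent ?_⟩
  rw [map_add, AlgHom.commutes, map_smul, toSkewLaurent_p, ← sub_eq_iff_eq_add', ← hFdef]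
  ext k : 1
  rw [cf_smul, cf_single]
  split_ifs with hk
  · subst hk
    rw [smul_eq_C_mul, mul_one]
    exact eq_C_of_natDegree_eq_zero h2
  · rw [h6 k (Ne.symm hk), smul_zero]

theorem adjoin_eq_top_of_mem_DLe {z w : A₁ K} (hz : z ∈ DLe K 0) (h : z * w - w * z = 1) :
    Algebra.adjoin K {z, w} = ⊤ := by
  obtain ⟨a, c, ha, rfl⟩ := eq_affine_of_mem_DLe hz h
  set z := algebraMap K (A₁ K) c + a • p K with hzdef
  have hpw : p K * (a • w - q K) - (a • w - q K) * p K = 0 := by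
    have h1 : p K * (a • w) - (a • w) * p K = 1 := by
      rw [← h, hzdef, add_mul, mul_add, Algebra.commutes c]
      simp only [smul_mul_assoc, mul_smul_comm]
      abel
    rw [mul_sub, sub_mul]
    calc _ = (p K * (a • w) - (a • w) * p K) - (p K * q K - q K * p K) := by abel
      _ = 0 := by rw [h1, p_mul_q_sub, sub_self]
  obtain ⟨f, hf⟩ := exists_aeval_of_commute hpw
  have hzS : z ∈ Algebra.adjoin K {z, w} := Algebra.subset_adjoin (by simp)
  have hwS : w ∈ Algebra.adjoin K {z, w} := Algebra.subset_adjoin (by simp)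
  have hpS : p K ∈ Algebra.adjoin K {z, w} := by
    have hp : p K = a⁻¹ • (z - algebraMap K _ c) := by
      rw [hzdef, add_sub_cancel_left, inv_smul_smul₀ ha]
    rw [hp]
    exact Subalgebra.smul_mem _ (sub_mem hzS (Subalgebra.algebraMap_mem _ c)) _
  have hqS : q K ∈ Algebra.adjoin K {z, w} := by
    have hq : q K = a • w - aeval (p K) f := by rw [← hf]; abel
    rw [hq]
    refine sub_mem (Subalgebra.smul_mem _ hwS _) ?_
    exact Algebra.adjoin_le (Set.singleton_subset_iff.2 hpS)
      (aeval_mem_adjoin_singleton K (p K))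
  rw [eq_top_iff, ← adjoin_p_q]
  refine Algebra.adjoin_le ?_
  rintro x (rfl | rfl)
  exacts [hpS, hqS]

end Representation

/-! ### The equivalence -/

theorem dixmierConjecture_iff (K : Type u) [Field K] [CharZero K] :
    DixmierConjecture K ↔ ∀ z w : A₁ K, z * w - w * z = 1 →
      ∃ ψ : A₁ K ≃ₐ[K] A₁ K, ψ z ∈ DLe K 0 := by
  constructor
  · intro hDC z w h
    have hsurj : Function.Surjective (lift (K := K) z w h) := by
      rw [← AlgHom.range_eq_top, eq_top_iff, ← hDC z w h]
      refine Algebra.adjoin_le ?_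
      rintro x (rfl | rfl)
      exacts [⟨p K, lift_p (K := K) _ _ h⟩, ⟨q K, lift_q (K := K) _ _ h⟩]
    let φ := AlgEquiv.ofBijective (lift (K := K) z w h) ⟨algHom_injective _, hsurj⟩
    refine ⟨φ.symm, ?_⟩
    have hφ : φ.symm z = p K := by
      rw [AlgEquiv.symm_apply_eq]
      exact (lift_p z w h).symm
    rw [hφ]
    -- `p = p ^ 1 * q ^ 0` has degree `0 - 1 = -1`.
    exact Submodule.mem_iSup_of_mem (-1) (Submodule.mem_iSup_of_mem (by norm_num)
      (Submodule.subset_span ⟨1, 0, by norm_num, by simp⟩))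
  · intro H z w h
    obtain ⟨ψ, hψ⟩ := H z w h
    have htop := adjoin_eq_top_of_mem_DLe hψ (w := ψ w)
      (by rw [← map_mul, ← map_mul, ← map_sub, h, map_one])
    have hmap : (Algebra.adjoin K {z, w}).map ψ.toAlgHom = ⊤ := by
      rw [AlgHom.map_adjoin, Set.image_pair]
      exact htop
    rw [eq_top_iff]
    intro x _
    have hx : ψ x ∈ (Algebra.adjoin K {z, w}).map ψ.toAlgHom := by rw [hmap]; trivial
    obtain ⟨y, hy, hyx⟩ := hx
    rwa [← ψ.injective hyx]

end FirstWeyl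

theorem mainTheorem8 (K : Type u) [Field K] [CharZero K] :
    FirstWeyl.DixmierConjecture K ↔
      ∀ z w : FirstWeyl.A₁ K, z * w - w * z = 1 →
        ∃ ψ : FirstWeyl.A₁ K ≃ₐ[K] FirstWeyl.A₁ K, ψ z ∈ FirstWeyl.DLe K 0 :=
  FirstWeyl.dixmierConjecture_iff K
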